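/- For an abelian topological group $(G,\tau)$, a character is a continuous homomorphism from $G$ to the unit circle $\mathbb{S}$; put $\mathbb{S}_+=\{z\in\mathbb{S}:\operatorname{Re} z\ge 0\}$. A set $A\subseteq G$ is quasi-convex if for every $g\in G\setminus A$ there is a character $\chi$ with $\chi(g)\notin\mathbb{S}_+$ and $\chi(A)\subseteq\mathbb{S}_+$; $(G,\tau)$ is locally quasi-convex (lqc) if the neutral element has a neighborhood base of quasi-convex sets. Two group topologies on $G$ are compatible if they have the same characters. An lqc group topology $\mu$ is Mackey if it is finer than or equal to every lqc group topology on $G$ compatible with $\mu$. An lqc group $(G,\tau)$ is pre-Mackey if $G$ has a Mackey group topology compatible with $\tau$, and quasi-Mackey if no lqc group topology on $G$ compatible with $\tau$ is strictly finer than $\tau$. For a space $X$, let $A(X)$ be the free abelian topological group over $X$, that is, the free abelian group on $X$ with the finest group topology for which the canonical map $X\to A(X)$ is continuous. A space is zero-dimensional if it is a nonempty $T_1$-space with a base of closed-and-open sets. Theorem. Let $X$ be a zero-dimensional space. Assume that there exist a family $\{U_i : i\in\kappa\}$ of pairwise disjoint closed-and-open subsets of $X$ and a non-isolated point $x_\infty\in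 X$ such that $\bigcup_{i\in\kappa}U_i=X\setminus\{x_\infty\}$. Then $A(X)$ is a locally quasi-convex group that is neither pre-Mackey nor quasi-Mackey. -/

import Mathlib

open Topology

namespace MackeyTop

/-! ### Characters, compatible topologies, local quasi-convexity

Group topologies on an abelian group `G` are terms of `AddGroupTopology G`.  In Mathlib's order on
topologies `μ ≤ ν` says that `μ` is finer than `ν` (every `ν`-open set is `μ`-open). -/

section Groups

variable {G : Type*} [AddCommGroup G]

/-- The set of continuous characters of `(G, τ)`: the `τ`-continuous homomorphisms from `G` to the
multiplicative circle group. -/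
def dual (τ : AddGroupTopology G) : Set (AddChar G Circle) :=
  {χ | @Continuous G Circle τ.toTopologicalSpace _ χ}

/-- Two group topologies are compatible if they have the same continuous characters. -/
def Compatible (μ ν : AddGroupTopology G) : Prop := dual μ = dual ν

/-- The right half `{z : Re z ≥ 0}` of the unit circle. -/
def circlePos : Set Circle := {z | 0 ≤ (z : ℂ).re}

/-- `A` is quasi-convex in `(G, τ)`: every point outside `A` is separated from `A` by a continuous
character. -/
def IsQuasiConvex (τ : AddGroupTopology G) (A : Set G) : Prop :=
  ∀ g, g ∉ A → ∃ χ ∈ dual τ, χ g ∉ circlePos ∧ ∀ x ∈ A, χ x ∈ circlePos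

/-- `(G, τ)` is locally quasi-convex: the neutral element has a neighborhood base of quasi-convex
sets. -/
def IsLocallyQuasiConvex (τ : AddGroupTopology G) : Prop :=
  (@nhds G τ.toTopologicalSpace 0).HasBasis
    (fun A : Set G => A ∈ @nhds G τ.toTopologicalSpace 0 ∧ IsQuasiConvex τ A) id

/-- `(G, μ)` is a Mackey group: `μ` is locally quasi-convex, and it is finer than every locally
quasi-convex group topology compatible with it. -/
def IsMackey (μ : AddGroupTopology G) : Prop :=
  IsLocallyQuasiConvex μ ∧ ∀ ν : AddGroupTopology G,
    IsLocallyQuasiConvex ν → Compatible ν μ → μ ≤ ν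

/-- `(G, τ)` is pre-Mackey: there is a Mackey group topology on `G` compatible with `τ`. -/
def IsPreMackey (τ : AddGroupTopology G) : Prop :=
  ∃ μ : AddGroupTopology G, IsMackey μ ∧ Compatible μ τ

/-- `μ` is a quasi-Mackey group topology for `(G, τ)`: it is locally quasi-convex and compatible
with `τ`, and no locally quasi-convex group topology compatible with `τ` is strictly finer. -/
def IsQuasiMackeyTopology (τ μ : AddGroupTopology G) : Prop :=
  IsLocallyQuasiConvex μ ∧ Compatible μ τ ∧
    ¬ ∃ ν : AddGroupTopology G, IsLocallyQuasiConvex ν ∧ Compatible ν τ ∧ ν < μ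

/-- `(G, τ)` is quasi-Mackey: `τ` itself is a quasi-Mackey group topology for `(G, τ)`. -/
def IsQuasiMackey (τ : AddGroupTopology G) : Prop := IsQuasiMackeyTopology τ τ

end Groups

/-! ### Zero-dimensional spaces -/

/-- A zero-dimensional space: a nonempty `T₁`-space with a base of closed-and-open sets. -/
structure IsZeroDimensional (X : Type*) [TopologicalSpace X] : Prop where
  nonempty : Nonempty X
  t1 : T1Space X
  basis : TopologicalSpace.IsTopologicalBasis {s : Set X | IsClopen s}

/-! ### The free abelian topological group -/

section Free

variable (X : Type*) [TopologicalSpace X]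

/-- The topology of the free abelian topological group `A(X)`: the finest group topology on the
free abelian group on `X` for which the canonical map from `X` is continuous. -/
def freeTopology : AddGroupTopology (FreeAbelianGroup X) :=
  AddGroupTopology.coinduced (FreeAbelianGroup.of : X → FreeAbelianGroup X)

/-- The universal property: every continuous map from `X` to an abelian topological group extends
uniquely to a continuous homomorphism on `A(X)`. -/
theorem freeTopology_existsUnique {H : Type*} [AddCommGroup H] [TopologicalSpace H]
    [IsTopologicalAddGroup H] (f : X → H) (hf : Continuous f) :
    ∃! F : FreeAbelianGroup X →+ H,
      @Continuous _ _ (freeTopology X).toTopologicalSpace _ F ∧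
        ∀ x, F (FreeAbelianGroup.of x) = f x := by
  refine ⟨FreeAbelianGroup.lift f, ⟨?_, fun x => FreeAbelianGroup.lift_apply_of f x⟩, ?_⟩
  · let σ : AddGroupTopology (FreeAbelianGroup X) :=
      { toTopologicalSpace := TopologicalSpace.induced (FreeAbelianGroup.lift f) inferInstance
        toIsTopologicalAddGroup := topologicalAddGroup_induced _ }
    have h1 : freeTopology X ≤ σ := by
      refine sInf_le ?_
      change TopologicalSpace.coinduced _ _ ≤ TopologicalSpace.induced _ _
      rw [← continuous_iff_coinduced_le, continuous_induced_rng]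
      have : (FreeAbelianGroup.lift f : FreeAbelianGroup X → H) ∘ FreeAbelianGroup.of = f :=
        funext fun x => FreeAbelianGroup.lift_apply_of f x
      rw [this]
      exact hf
    exact continuous_iff_le_induced.2 h1
  · rintro F ⟨-, hF⟩
    refine FreeAbelianGroup.lift_ext _ _ fun x => ?_
    rw [hF, FreeAbelianGroup.lift_apply_of]

variable {X} in
/-- A zero-dimensional space `X` is a subspace of `A(X)`. -/
theorem isEmbedding_of (hX : IsZeroDimensional X) :
    @IsEmbedding X (FreeAbelianGroup X) _ (freeTopology X).toTopologicalSpace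
      FreeAbelianGroup.of := by
  let _ := (freeTopology X).toTopologicalSpace
  have hc : Continuous (FreeAbelianGroup.of : X → FreeAbelianGroup X) :=
    AddGroupTopology.coinduced_continuous _
  refine ⟨⟨le_antisymm (continuous_iff_le_induced.1 hc) ?_⟩, FreeAbelianGroup.of_injective⟩
  refine le_trans (le_generateFrom ?_) hX.basis.eq_generateFrom.ge
  intro s hs
  have hs' : IsClopen s := hs
  classical
  obtain ⟨F, ⟨hF, hFx⟩, -⟩ := freeTopology_existsUnique X
    (s.indicator (fun _ => (1 : ℤ))) (continuous_const.indicator (by simp [hs'.frontier_eq]))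
  refine ⟨F ⁻¹' {1}, (isOpen_discrete _).preimage hF, ?_⟩
  ext x
  by_cases hx : x ∈ s <;> simp [hFx, hx]

end Free

end MackeyTop

namespace MackeyTop

/-! ### The circle -/

/-! For a circle element `c`, refine the topology of A(X) by uniform convergence on the characters
`g ↦ c ^ (sum of g over U i)`. For `c = e^i` and for `-c = e^(i(1+π))`, whose nontrivial powers
generate dense subgroups, this gives two locally quasi-convex topologies compatible with A(X)
(`compatible_blockTopology`). They have no compatible common refinement: if `c ^ m` and `(-c) ^ m`
are both close to `1`, then `m` is even, so in a common refinement all block sums are even near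
zero. The character that is `-1` off `x_∞` and `1` at `x_∞` then becomes continuous, although it is
discontinuous on X because `x_∞` is not isolated. A Mackey topology would refine both; if A(X) were
quasi-Mackey, it would coincide with both.

Compatibility: let `χ` be continuous for the refinement and `χ(x - x_∞) → u` along an ultrafilter `x
→ x_∞`. If `c ^ m` is close to `1`, sums of `L` terms `m(x_j - x_∞)`, with no two `x_j` in the same
block, are small in the refinement for every `L`. So all `u ^ (mL)` stay near `1`, whence `u ^ m =
1`; density of powers yields `u = 1`.

Local quasi-convexity of A(X) holds for every X: a neighborhood of zero contains a seminorm ball,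
and Kantorovich duality bounds the seminorm of `g` by the values at `g` of Lipschitz functions,
which are phases of continuous characters. -/

theorem Circle.dist_eq (z w : Circle) : dist z w = ‖(z : ℂ) - w‖ :=
  Complex.dist_eq (z : ℂ) w

theorem Circle.dist_le_two (a b : Circle) : dist a b ≤ 2 := by
  rw [Circle.dist_eq]
  refine (norm_sub_le _ _).trans ?_
  rw [Circle.norm_coe, Circle.norm_coe, one_add_one_eq_two]

/-- `|z² - 1| = |z - 1| |z + 1|`, and `|z + 1|² = 2 + 2 Re z ≥ 2` on the right half circle. -/
theorem dist_one_le_of_mem_circlePos {z : Circle} (hz : z ∈ circlePos) :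
    dist z 1 ≤ dist (z ^ 2) 1 / √2 := by
  have h1 : (0 : ℝ) ≤ (z : ℂ).re := hz
  have hn : (z : ℂ).re * (z : ℂ).re + (z : ℂ).im * (z : ℂ).im = 1 := by
    have := Circle.normSq_coe z
    rwa [Complex.normSq_apply] at this
  have key : dist (z ^ 2) 1 = dist z 1 * ‖(z : ℂ) + 1‖ := by
    simp only [Circle.dist_eq, Circle.coe_pow, Circle.coe_one]
    rw [← norm_mul]
    congr 1
    ring
  have h2 : √2 ≤ ‖(z : ℂ) + 1‖ := by
    rw [Complex.norm_def]
    apply Real.sqrt_le_sqrt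
    rw [Complex.normSq_apply]
    simp only [Complex.add_re, Complex.add_im, Complex.one_re, Complex.one_im]
    nlinarith
  rw [le_div_iff₀ (by positivity), key]
  exact mul_le_mul_of_nonneg_left h2 dist_nonneg

theorem dist_one_le_of_pow_mem_circlePos (n : ℕ) {z : Circle}
    (hz : ∀ j ≤ n, z ^ (2 ^ j) ∈ circlePos) : dist z 1 ≤ 2 / √2 ^ n := by
  induction n generalizing z with
  | zero =>
    simpa using Circle.dist_le_two z 1
  | succ n ih =>
    have h0 : z ∈ circlePos := by simpa using hz 0 (Nat.zero_le _)
    have h2 : dist (z ^ 2) 1 ≤ 2 / √2 ^ n := by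
      refine ih fun j hj => ?_
      rw [← pow_mul, ← pow_succ']
      exact hz (j + 1) (by omega)
    calc dist z 1 ≤ dist (z ^ 2) 1 / √2 := dist_one_le_of_mem_circlePos h0
      _ ≤ 2 / √2 ^ n / √2 := by gcongr
      _ = 2 / √2 ^ (n + 1) := by rw [div_div, pow_succ]

theorem exists_two_div_sqrt_two_pow_lt {ε : ℝ} (hε : 0 < ε) : ∃ n : ℕ, 2 / √2 ^ n < ε := by
  obtain ⟨n, hn⟩ := pow_unbounded_of_one_lt (2 / ε) (Real.lt_sqrt (by norm_num) |>.2
    (by norm_num) : (1 : ℝ) < √2)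
  refine ⟨n, ?_⟩
  rw [div_lt_iff₀ hε] at hn
  rw [div_lt_iff₀ (by positivity)]
  linarith

theorem eq_one_of_forall_pow_mem_circlePos {z : Circle} (hz : ∀ n : ℕ, z ^ n ∈ circlePos) :
    z = 1 := by
  rw [← dist_le_zero]
  refine le_of_forall_gt fun ε hε => ?_
  obtain ⟨n, hn⟩ := exists_two_div_sqrt_two_pow_lt hε
  exact (dist_one_le_of_pow_mem_circlePos n fun j _ => hz _).trans_lt hn

theorem mem_circlePos_of_dist_one_le {z : Circle} (hz : dist z 1 ≤ 1) : z ∈ circlePos := by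
  rw [Circle.dist_eq] at hz
  have h := (Complex.abs_re_le_norm ((z : ℂ) - 1)).trans hz
  rw [abs_le, Complex.sub_re, Complex.one_re] at h
  change 0 ≤ (z : ℂ).re
  linarith [h.1]

theorem Circle.dist_mul_left (a b c : Circle) : dist (a * b) (a * c) = dist b c := by
  simp only [Circle.dist_eq, Circle.coe_mul, ← mul_sub, norm_mul,
    Circle.norm_coe, one_mul]

theorem Circle.dist_mul_one_le (a b : Circle) : dist (a * b) 1 ≤ dist a 1 + dist b 1 := by
  have h := dist_triangle (a * b) (a * 1) 1
  rw [Circle.dist_mul_left, mul_one] at h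
  linarith

theorem Circle.dist_inv_one (a : Circle) : dist a⁻¹ 1 = dist a 1 := by
  rw [← Circle.dist_mul_left a, mul_inv_cancel, mul_one, dist_comm]

theorem Circle.dist_pow_one_le (a : Circle) (n : ℕ) : dist (a ^ n) 1 ≤ n * dist a 1 := by
  induction n with
  | zero => simp
  | succ n ih =>
    rw [pow_succ]
    refine (Circle.dist_mul_one_le _ _).trans ?_
    push_cast
    linarith

theorem Circle.dist_exp_exp_le (s t : ℝ) : dist (Circle.exp s) (Circle.exp t) ≤ |s - t| := by
  have h : Circle.exp s = Circle.exp t * Circle.exp (s - t) := by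
    rw [← Circle.exp_add]; congr 1; ring
  have h2 : dist (Circle.exp s) (Circle.exp t) = dist (Circle.exp (s - t)) 1 := by
    conv_lhs => rw [h, ← mul_one (Circle.exp t)]
    rw [mul_assoc, one_mul, Circle.dist_mul_left]
  rw [h2, Circle.dist_eq, Circle.coe_exp, Circle.coe_one]
  have := Real.norm_exp_I_mul_ofReal_sub_one_le (x := s - t)
  rwa [mul_comm, Real.norm_eq_abs] at this

/-! ### Topologies of uniform convergence on families of characters -/

section Groups

variable {G : Type*} [AddCommGroup G]

/-- The group topology defined by a group seminorm. -/
def seminormTopology (N : AddGroupSeminorm G) : AddGroupTopology G :=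
  let _ := N.toSeminormedAddCommGroup
  { toTopologicalSpace := inferInstance
    toIsTopologicalAddGroup := inferInstance }

theorem nhds_seminormTopology (N : AddGroupSeminorm G) (g : G) :
    (@nhds G (seminormTopology N).toTopologicalSpace g).HasBasis (fun ε : ℝ => 0 < ε)
      fun ε => {h | N (h - g) < ε} := by
  let _ := N.toSeminormedAddCommGroup
  have h : (fun ε => {h | N (h - g) < ε}) = Metric.ball g := by
    ext ε h
    change N (h - g) < ε ↔ N (-h + g) < ε
    rw [neg_add_eq_sub, map_sub_rev]
  rw [h]
  exact Metric.nhds_basis_ball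

/-- The supremum of the distances to `1` of the values of a family of characters. -/
noncomputable def uniformSeminorm {ι : Type*} (χ : ι → AddChar G Circle) : AddGroupSeminorm G where
  toFun g := ⨆ i, dist (χ i g) 1
  map_zero' := by simp
  add_le' g h := by
    have hb (k : G) : BddAbove (Set.range fun i => dist (χ i k) 1) :=
      ⟨2, by rintro _ ⟨i, rfl⟩; exact Circle.dist_le_two _ _⟩
    refine Real.iSup_le (fun i => ?_) (add_nonneg (Real.iSup_nonneg fun i => dist_nonneg)
      (Real.iSup_nonneg fun i => dist_nonneg))
    rw [AddChar.map_add_eq_mul]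
    exact (Circle.dist_mul_one_le _ _).trans (add_le_add (le_ciSup (hb g) i) (le_ciSup (hb h) i))
  neg' g := by simp [AddChar.map_neg_eq_inv, Circle.dist_inv_one]

theorem dist_le_uniformSeminorm {ι : Type*} (χ : ι → AddChar G Circle) (i : ι) (g : G) :
    dist (χ i g) 1 ≤ uniformSeminorm χ g :=
  le_ciSup (f := fun i => dist (χ i g) 1)
    ⟨2, by rintro _ ⟨i, rfl⟩; exact Circle.dist_le_two _ _⟩ i

theorem uniformSeminorm_le {ι : Type*} {χ : ι → AddChar G Circle} {g : G} {ε : ℝ} (hε : 0 ≤ ε)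
    (h : ∀ i, dist (χ i g) 1 ≤ ε) : uniformSeminorm χ g ≤ ε :=
  Real.iSup_le h hε

theorem dual_anti {μ ν : AddGroupTopology G} (h : μ ≤ ν) : dual ν ⊆ dual μ := fun _ hχ =>
  continuous_le_dom (AddGroupTopology.toTopologicalSpace_le.2 h) hχ

/-- A character is continuous as soon as it is continuous at zero. -/
theorem mem_dual_of_tendsto {τ : AddGroupTopology G} {χ : AddChar G Circle}
    (h : Filter.Tendsto χ (@nhds G τ.toTopologicalSpace 0) (𝓝 1)) : χ ∈ dual τ := by
  let _ := τ.toTopologicalSpace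
  have := τ.toIsTopologicalAddGroup
  have : Continuous χ.toAddMonoidHom := by
    refine continuous_of_continuousAt_zero χ.toAddMonoidHom ?_
    rw [ContinuousAt, map_zero]
    exact (continuous_ofMul.tendsto _).comp h
  exact continuous_toMul.comp this

theorem IsQuasiConvex.mono {μ ν : AddGroupTopology G} {A : Set G} (hA : IsQuasiConvex ν A)
    (h : μ ≤ ν) : IsQuasiConvex μ A := fun g hg =>
  let ⟨χ, hχ, h1⟩ := hA g hg
  ⟨χ, dual_anti h hχ, h1⟩

theorem IsQuasiConvex.inter {τ : AddGroupTopology G} {A B : Set G} (hA : IsQuasiConvex τ A)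
    (hB : IsQuasiConvex τ B) : IsQuasiConvex τ (A ∩ B) := by
  intro g hg
  by_cases h : g ∈ A
  · obtain ⟨χ, hχ, h1, h2⟩ := hB g fun h' => hg ⟨h, h'⟩
    exact ⟨χ, hχ, h1, fun x hx => h2 x hx.2⟩
  · obtain ⟨χ, hχ, h1, h2⟩ := hA g h
    exact ⟨χ, hχ, h1, fun x hx => h2 x hx.1⟩

theorem isQuasiConvex_polar {τ : AddGroupTopology G} {ι : Type*} {χ : ι → AddChar G Circle}
    (hχ : ∀ i, χ i ∈ dual τ) : IsQuasiConvex τ {g | ∀ i, χ i g ∈ circlePos} := by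
  intro g hg
  simp only [Set.mem_ofPred_eq, not_forall] at hg
  obtain ⟨i, hi⟩ := hg
  exact ⟨χ i, hχ i, hi, fun x hx => hx i⟩

theorem isLocallyQuasiConvex_iff {τ : AddGroupTopology G} : IsLocallyQuasiConvex τ ↔
    ∀ V ∈ @nhds G τ.toTopologicalSpace 0, ∃ A ∈ @nhds G τ.toTopologicalSpace 0,
      IsQuasiConvex τ A ∧ A ⊆ V := by
  refine ⟨fun h V hV => ?_, fun h => ⟨fun V => ⟨fun hV => ?_, ?_⟩⟩⟩
  · obtain ⟨A, ⟨h1, h2⟩, h3⟩ := (Filter.HasBasis.mem_iff h).1 hV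
    exact ⟨A, h1, h2, h3⟩
  · obtain ⟨A, h1, h2, h3⟩ := h V hV
    exact ⟨A, ⟨h1, h2⟩, h3⟩
  · rintro ⟨A, ⟨h1, h2⟩, h3⟩
    exact Filter.mem_of_superset h1 h3

theorem nhds_inf_seminormTopology (τ : AddGroupTopology G) (N : AddGroupSeminorm G) (g : G) :
    @nhds G (τ ⊓ seminormTopology N).toTopologicalSpace g =
      @nhds G τ.toTopologicalSpace g ⊓ @nhds G (seminormTopology N).toTopologicalSpace g := by
  rw [AddGroupTopology.toTopologicalSpace_inf, nhds_inf]

/-- Refining a locally quasi-convex topology by uniform convergence on a family of continuous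
characters preserves local quasi-convexity. -/
theorem IsLocallyQuasiConvex.inf_uniform {τ : AddGroupTopology G} (hτ : IsLocallyQuasiConvex τ)
    {ι : Type*} {χ : ι → AddChar G Circle} (hχ : ∀ i, χ i ∈ dual τ) :
    IsLocallyQuasiConvex (τ ⊓ seminormTopology (uniformSeminorm χ)) := by
  rw [isLocallyQuasiConvex_iff] at hτ ⊢
  intro V hV
  rw [nhds_inf_seminormTopology, Filter.mem_inf_iff_superset] at hV
  obtain ⟨V₁, hV₁, V₂, hV₂, hV⟩ := hV
  obtain ⟨ε, hε, hεV⟩ := (nhds_seminormTopology _ _).mem_iff.1 hV₂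
  obtain ⟨A, hA, hAq, hAV⟩ := hτ V₁ hV₁
  obtain ⟨n, hn⟩ := exists_two_div_sqrt_two_pow_lt hε
  -- Membership of the powers `2 ^ j`, `j ≤ n`, in the right half circle forces distance at most `2
  -- / √2 ^ n < ε` from `1`; conversely distance below `1 / 2 ^ n` ensures that membership. So the
  -- polar of these powers is a neighborhood inside the `ε`-ball.
  let ψ : ι × Fin (n + 1) → AddChar G Circle := fun p => χ p.1 ^ (2 ^ (p.2 : ℕ))
  have hψ : ∀ p, ψ p ∈ dual τ := fun p => by
    let _ := τ.toTopologicalSpace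
    have : Continuous fun g => (χ p.1 g) ^ (2 ^ (p.2 : ℕ)) := Continuous.pow (hχ p.1) _
    exact this
  refine ⟨A ∩ {g | ∀ p, ψ p g ∈ circlePos}, ?_,
    (hAq.inter (isQuasiConvex_polar hψ)).mono inf_le_left, ?_⟩
  · rw [nhds_inf_seminormTopology]
    refine Filter.inter_mem_inf hA ((nhds_seminormTopology _ _).mem_iff.2
      ⟨1 / 2 ^ n, by positivity, fun g hg p => mem_circlePos_of_dist_one_le ?_⟩)
    simp only [sub_zero, Set.mem_ofPred_eq] at hg
    have h1 := (dist_le_uniformSeminorm χ p.1 g).trans hg.le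
    have h2 : (2 : ℝ) ^ (p.2 : ℕ) ≤ 2 ^ n := pow_le_pow_right₀ (by norm_num) (by omega)
    calc dist (ψ p g) 1 ≤ (2 ^ (p.2 : ℕ) : ℕ) * dist (χ p.1 g) 1 := Circle.dist_pow_one_le _ _
      _ ≤ 2 ^ n * (1 / 2 ^ n) := by push_cast; gcongr
      _ = 1 := by field_simp
  · rintro g ⟨hgA, hg⟩
    refine hV ⟨hAV hgA, hεV ?_⟩
    rw [Set.mem_ofPred_eq, sub_zero]
    refine (uniformSeminorm_le (by positivity) fun i => ?_).trans_lt hn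
    exact dist_one_le_of_pow_mem_circlePos n fun j hj => hg (i, ⟨j, by omega⟩)

end Groups

/-! ### Characters of the free abelian topological group -/

section Free

variable {X : Type*} [TopologicalSpace X]

theorem freeTopology_le {σ : AddGroupTopology (FreeAbelianGroup X)}
    (h : @Continuous X _ _ σ.toTopologicalSpace FreeAbelianGroup.of) : freeTopology X ≤ σ :=
  sInf_le (continuous_iff_coinduced_le.1 h)

theorem continuous_of : @Continuous X _ _ (freeTopology X).toTopologicalSpace
    FreeAbelianGroup.of :=
  AddGroupTopology.coinduced_continuous _

theorem mem_dual_freeTopology {χ : AddChar (FreeAbelianGroup X) Circle} :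
    χ ∈ dual (freeTopology X) ↔ Continuous fun x : X => χ (FreeAbelianGroup.of x) := by
  let _ := (freeTopology X).toTopologicalSpace
  refine ⟨fun h => Continuous.comp (g := χ) h continuous_of, fun h => ?_⟩
  obtain ⟨F, ⟨hF, hFx⟩, -⟩ := freeTopology_existsUnique X
    (fun x => Additive.ofMul (χ (FreeAbelianGroup.of x))) (continuous_ofMul.comp h)
  have : χ.toAddMonoidHom = F := FreeAbelianGroup.lift_ext _ _ fun x => by simp [hFx]
  have h2 : (χ : FreeAbelianGroup X → Circle) = Additive.toMul ∘ F := by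
    rw [← this]; rfl
  change Continuous χ
  rw [h2]
  exact continuous_toMul.comp hF

end Free

/-! ### Kantorovich duality for finite transportation problems with unit masses -/

open Finset in
/-- Approximate complementary slackness for the assignment problem. -/
theorem exists_perm_forall_le {ι : Type*} [Fintype ι] [Nonempty ι] (w : ι → ι → ℝ) {δ : ℝ}
    (hδ : 0 < δ) : ∃ (v : ι → ℝ) (σ : Equiv.Perm ι),
      ∀ i j, v (σ i) + w i (σ i) ≤ v j + w i j + δ := by
  classical
  let u : (ι → ℝ) → ι → ℝ := fun v i => univ.inf' univ_nonempty fun j => v j + w i j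
  have hu (v : ι → ℝ) (i j : ι) : u v i ≤ v j + w i j :=
    inf'_le (fun j => v j + w i j) (mem_univ j)
  -- The dual objective of the assignment problem; `v` is chosen within `δ` of its supremum, and `t
  -- i` collects the pairs that are tight up to `δ`.
  let Φ : (ι → ℝ) → ℝ := fun v => ∑ i, u v i - ∑ j, v j
  have hbdd : BddAbove (Set.range Φ) := by
    refine ⟨∑ i, w i i, ?_⟩
    rintro _ ⟨v, rfl⟩
    rw [sub_le_iff_le_add, ← sum_add_distrib]
    exact sum_le_sum fun i _ => (hu v i i).trans_eq (add_comm _ _)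
  obtain ⟨_, ⟨v, rfl⟩, hv⟩ := exists_lt_of_lt_csSup (Set.range_nonempty Φ)
    (sub_lt_self (sSup (Set.range Φ)) hδ)
  let t : ι → Finset ι := fun i => univ.filter fun j => v j + w i j ≤ u v i + δ
  -- Hall's condition: if `S` had too few neighbors, raising `v` by `δ` on them would raise `u` by
  -- at least `δ` on `S` and lower it nowhere, so `Φ` would gain at least `δ`, contradicting
  -- near-optimality.
  have hall (S : Finset ι) : S.card ≤ (S.biUnion t).card := by
    by_contra! hS
    let v' : ι → ℝ := fun j => v j + if j ∈ S.biUnion t then δ else 0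
    have hu' (i : ι) : u v i + (if i ∈ S then δ else 0) ≤ u v' i := by
      refine le_inf' _ _ fun j _ => ?_
      have h1 := hu v i j
      by_cases hi : i ∈ S
      · by_cases hj : j ∈ S.biUnion t
        · simp only [v', if_pos hi, if_pos hj]
          linarith
        · have h2 : j ∉ t i := fun h => hj (mem_biUnion.2 ⟨i, hi, h⟩)
          simp only [t, mem_filter, mem_univ, true_and, not_le] at h2
          simp only [v', if_pos hi, if_neg hj]
          linarith
      · have h3 : (0 : ℝ) ≤ if j ∈ S.biUnion t then δ else 0 := by split_ifs <;> linarith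
        simp only [v', if_neg hi]
        linarith
    have h1 := sum_le_sum fun i (_ : i ∈ univ) => hu' i
    have h2 : Φ v' ≤ sSup (Set.range Φ) := le_csSup hbdd ⟨v', rfl⟩
    have h3 : ((S.biUnion t).card : ℝ) + 1 ≤ S.card := by exact_mod_cast hS
    simp only [sum_add_distrib, sum_ite_mem, univ_inter, sum_const, nsmul_eq_mul] at h1
    simp only [Φ, v', sum_add_distrib, sum_ite_mem, univ_inter, sum_const, nsmul_eq_mul] at h2 hv
    nlinarith
  obtain ⟨f, hf, hft⟩ := (all_card_le_biUnion_card_iff_exists_injective t).1 hall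
  refine ⟨v, Equiv.ofBijective f (Finite.injective_iff_bijective.1 hf), fun i j => ?_⟩
  have h1 := hft i
  simp only [t, mem_filter, mem_univ, true_and] at h1
  simp only [Equiv.ofBijective_apply]
  linarith [hu v i j]

/-- Approximate Kantorovich duality: an optimal matching is almost realized by a function that is
`1`-Lipschitz for the pseudometric `d`. -/
theorem exists_lipschitz_perm_sum_le {X ι : Type*} [Fintype ι] {d : X → X → ℝ}
    (d_self : ∀ x, d x x = 0) (d_triangle : ∀ x y z, d x z ≤ d x y + d y z) (x y : ι → X)
    {δ : ℝ} (hδ : 0 < δ) : ∃ (f : X → ℝ) (σ : Equiv.Perm ι), (∀ a b, f a - f b ≤ d a b) ∧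
      ∑ i, d (x i) (y (σ i)) ≤ ∑ i, f (x i) - ∑ i, f (y i) + δ := by
  cases isEmpty_or_nonempty ι
  · have hd (a b : X) : 0 ≤ d a b + d b a := (d_self a).symm.le.trans (d_triangle a b a)
    by_cases hX : Nonempty X
    · obtain ⟨c⟩ := hX
      refine ⟨fun a => d a c, Equiv.refl _, fun a b => ?_, by simpa using hδ.le⟩
      linarith [d_triangle a b c]
    · exact ⟨fun _ => 0, Equiv.refl _, fun a => (hX ⟨a⟩).elim, by simpa using hδ.le⟩
  · obtain ⟨v, σ, hσ⟩ := exists_perm_forall_le (fun i j => d (x i) (y j))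
      (div_pos hδ (Nat.cast_pos.2 (Fintype.card_pos (α := ι))))
    -- The largest function that is `1`-Lipschitz for `d` and at most `v j` at each `y j`;
    -- approximate slackness makes it almost tight on matched pairs.
    let f : X → ℝ := fun z => Finset.univ.inf' Finset.univ_nonempty fun j => v j + d z (y j)
    have hf (z : X) (j : ι) : f z ≤ v j + d z (y j) :=
      Finset.inf'_le (fun j => v j + d z (y j)) (Finset.mem_univ j)
    refine ⟨f, σ, fun a b => ?_, ?_⟩
    · rw [sub_le_iff_le_add', ← sub_le_iff_le_add]
      refine Finset.le_inf' _ _ fun j _ => ?_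
      linarith [hf a j, d_triangle a b (y j)]
    · have h1 (i : ι) : d (x i) (y (σ i)) ≤ f (x i) - v (σ i) + δ / Fintype.card ι := by
        have : v (σ i) + d (x i) (y (σ i)) - δ / Fintype.card ι ≤ f (x i) :=
          Finset.le_inf' _ _ fun j _ => by linarith [hσ i j]
        linarith
      have h2 := Finset.sum_le_sum fun i (_ : i ∈ Finset.univ) => h1 i
      have h3 : ∑ i, f (y i) ≤ ∑ i, v i :=
        Finset.sum_le_sum fun i _ => by simpa [d_self] using hf (y i) i
      rw [Finset.sum_add_distrib, Finset.sum_sub_distrib, Equiv.sum_comp σ v] at h2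
      have h4 : (Fintype.card ι : ℝ) ≠ 0 := Nat.cast_ne_zero.2 Fintype.card_ne_zero
      simp only [Finset.sum_const, Finset.card_univ, nsmul_eq_mul, mul_div_cancel₀ _ h4] at h2
      linarith

/-! ### Continuous seminorms on abelian topological groups -/

section Seminorm

variable {G : Type*} [AddCommGroup G]

open PseudoMetricSpace in
-- Translation maps chains onto chains of the same length sum. This invariance turns the chain
-- metric into a group seminorm.
theorem dist_ofPreNNDist_add_right (p : G → NNReal) (h0 : ∀ x, p (x - x) = 0)
    (hc : ∀ x y, p (x - y) = p (y - x)) (x y z : G) :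
    (ofPreNNDist (fun a b => p (a - b)) h0 hc).toDist.dist (x + z) (y + z) =
      (ofPreNNDist (fun a b => p (a - b)) h0 hc).toDist.dist x y := by
  rw [dist_ofPreNNDist, dist_ofPreNNDist, NNReal.coe_inj]
  symm
  refine Function.Surjective.iInf_congr (List.map (· + z))
    (List.map_surjective_iff.2 (add_right_surjective z)) fun l => ?_
  have h1 : (x + z) :: l.map (· + z) = (x :: l).map (· + z) := rfl
  have h2 : l.map (· + z) ++ [y + z] = (l ++ [y]).map (· + z) := by simp
  rw [h1, h2, List.zipWith_map]
  simp

/-- Every neighborhood of zero of an abelian topological group contains the unit ball of a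
continuous seminorm. -/
theorem exists_seminorm_ball_subset (τ : AddGroupTopology G) {V : Set G}
    (hV : V ∈ @nhds G τ.toTopologicalSpace 0) : ∃ N : AddGroupSeminorm G,
      (∀ ε > 0, {g | N g < ε} ∈ @nhds G τ.toTopologicalSpace 0) ∧ {g | N g < 1} ⊆ V := by
  classical
  let _ := τ.toTopologicalSpace
  have := τ.toIsTopologicalAddGroup
  have hstep (A : {A : Set G // A ∈ 𝓝 (0 : G)}) : ∃ B : {B : Set G // B ∈ 𝓝 (0 : G)},
      (∀ x ∈ B.1, -x ∈ B.1) ∧ ∀ x ∈ B.1, ∀ y ∈ B.1, ∀ z ∈ B.1, x + y + z ∈ A.1 := by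
    obtain ⟨B, hB, -, -, hBA⟩ := exists_closed_nhds_zero_neg_eq_add_subset A.2
    obtain ⟨C, hC, -, hCn, hCB⟩ := exists_closed_nhds_zero_neg_eq_add_subset hB
    refine ⟨⟨C, hC⟩, fun x hx => ?_, fun x hx y hy z hz => ?_⟩
    · exact Set.mem_neg.1 (hCn.symm ▸ (show x ∈ C from hx))
    · refine hBA (Set.add_mem_add (hCB (Set.add_mem_add hx hy)) (hCB ?_))
      rw [← add_zero z]
      exact Set.add_mem_add hz (mem_of_mem_nhds hC)
  choose next hnext_neg hnext_add using hstep
  -- The shift by one makes `W 0` itself symmetric, which `V` need not be.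
  let W : ℕ → Set G := fun n => (next^[n + 1] ⟨V, hV⟩).1
  have hWsucc (n : ℕ) : next^[n + 1 + 1] ⟨V, hV⟩ = next (next^[n + 1] ⟨V, hV⟩) :=
    Function.iterate_succ_apply' _ _ _
  have hW_nhds (n : ℕ) : W n ∈ 𝓝 (0 : G) := (next^[n + 1] ⟨V, hV⟩).2
  have hW0 (n : ℕ) : (0 : G) ∈ W n := mem_of_mem_nhds (hW_nhds n)
  have hW_neg (n : ℕ) (x : G) (hx : x ∈ W n) : -x ∈ W n := by
    simp only [W, Function.iterate_succ_apply'] at hx ⊢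
    exact hnext_neg _ x hx
  have hW_add (n : ℕ) (x y z : G) (hx : x ∈ W (n + 1)) (hy : y ∈ W (n + 1))
      (hz : z ∈ W (n + 1)) : x + y + z ∈ W n := by
    simp only [W, hWsucc] at hx hy hz
    exact hnext_add _ x hx y hy z hz
  have hW_anti : Antitone W := antitone_nat_of_succ_le fun n x hx => by
    simpa using hW_add n x 0 0 hx (hW0 _) (hW0 _)
  have hWV : W 0 ⊆ V := fun x hx => by
    simpa using hnext_add ⟨V, hV⟩ x hx 0 (hW0 0) 0 (hW0 0)
  let p : G → NNReal := fun g => if h : ∃ n, g ∉ W n then (1 / 2) ^ Nat.find h else 0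
  have hr : (1 / 2 : NNReal) ∈ Set.Ioo (0 : NNReal) 1 :=
    ⟨half_pos one_pos, NNReal.half_lt_self one_ne_zero⟩
  have hle_p {g : G} {n : ℕ} : (1 / 2) ^ n ≤ p g ↔ g ∉ W n := by
    dsimp only [p]
    split_ifs with h
    · rw [(pow_right_strictAnti₀ hr.1 hr.2).le_iff_ge, Nat.find_le_iff]
      exact ⟨fun ⟨m, hmn, hm⟩ hn => hm (hW_anti hmn hn), fun h => ⟨n, le_rfl, h⟩⟩
    · push Not at h
      simp only [h, not_true, (pow_pos hr.1 _).not_ge]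
  have hp0 (x : G) : p (x - x) = 0 := by simp [p, hW0]
  have hpc (x y : G) : p (x - y) = p (y - x) := by
    have (n : ℕ) : x - y ∈ W n ↔ y - x ∈ W n :=
      ⟨fun h => by simpa using hW_neg n _ h, fun h => by simpa using hW_neg n _ h⟩
    simp only [p, this]
  let I := PseudoMetricSpace.ofPreNNDist (fun a b => p (a - b)) hp0 hpc
  have hdist_le (x y : G) : dist x y ≤ p (x - y) :=
    PseudoMetricSpace.dist_ofPreNNDist_le _ hp0 hpc x y
  -- Metrization lemma: the triple-sum condition on `W` makes the chain metric comparable to `p` up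
  -- to a factor `2`, hence the factor in the seminorm below.
  have hp_le (x y : G) : (p (x - y) : ℝ) ≤ 2 * dist x y := by
    refine PseudoMetricSpace.le_two_mul_dist_ofPreNNDist _ hp0 hpc (fun x₁ x₂ x₃ x₄ => ?_) x y
    by_cases H : ∃ n, x₁ - x₄ ∉ W n
    · refine (dif_pos H).trans_le ?_
      rw [← div_le_iff₀' zero_lt_two, ← mul_one_div (_ ^ _), ← pow_succ]
      simp only [le_max_iff, hle_p, ← not_and_or]
      rintro ⟨h₁₂, h₂₃, h₃₄⟩
      refine Nat.find_spec H ?_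
      have := hW_add _ _ _ _ h₁₂ h₂₃ h₃₄
      rwa [sub_add_sub_cancel, sub_add_sub_cancel] at this
    · exact (dif_neg H).trans_le zero_le
  have hadd (x y z : G) : dist (x + z) (y + z) = dist x y :=
    dist_ofPreNNDist_add_right p hp0 hpc x y z
  refine ⟨⟨fun g => 2 * dist g 0, by simp, fun x y => ?_, fun x => ?_⟩, fun ε hε => ?_, ?_⟩
  · have h1 := hadd x 0 y
    have h2 := dist_triangle (x + y) (0 + y) 0
    rw [h1, zero_add] at h2
    linarith
  · have h1 := hadd (-x) 0 x
    rw [neg_add_cancel, zero_add, dist_comm 0 x] at h1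
    rw [h1]
  · obtain ⟨n, hn⟩ := exists_pow_lt_of_lt_one (half_pos hε) (by norm_num : (1 / 2 : ℝ) < 1)
    refine Filter.mem_of_superset (hW_nhds n) fun g hg => ?_
    have h1 : p (g - 0) < (1 / 2) ^ n := by rwa [← not_le, hle_p, not_not, sub_zero]
    have h2 : (p (g - 0) : ℝ) < (1 / 2) ^ n := by exact_mod_cast h1
    change 2 * dist g 0 < ε
    linarith [hdist_le g 0]
  · intro g hg
    have h1 : (p (g - 0) : ℝ) < 1 := (hp_le g 0).trans_lt hg
    rw [sub_zero] at h1
    refine hWV ?_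
    by_contra h
    have h2 := (hle_p (g := g) (n := 0)).2 h
    rw [pow_zero] at h2
    exact absurd h1 (not_lt.2 (by exact_mod_cast h2))

end Seminorm

/-! ### Local quasi-convexity of the free abelian topological group -/

section Free

/-- All `t` in `[0, 1]` are used to exclude wrapping around the circle: if `|a| > π / 2`, some `t`
gives `t|a| = min |a| π`, whose cosine is negative. -/
theorem abs_le_of_forall_exp_mem_circlePos {a : ℝ}
    (h : ∀ t ∈ Set.Icc (0 : ℝ) 1, Circle.exp (t * a) ∈ circlePos) : |a| ≤ Real.pi / 2 := by
  by_contra! ha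
  have ha0 : 0 < |a| := (by positivity : (0 : ℝ) < Real.pi / 2).trans ha
  have h1 := h (min |a| Real.pi / |a|) ⟨by positivity, div_le_one_of_le₀ (min_le_left _ _) ha0.le⟩
  have h2 : Real.cos (min |a| Real.pi / |a| * a) = Real.cos (min |a| Real.pi) := by
    rw [← Real.cos_abs (_ * a), abs_mul, abs_div, abs_abs, div_mul_cancel₀ _ ha0.ne',
      Real.cos_abs]
  change 0 ≤ (Circle.exp _ : ℂ).re at h1
  rw [Circle.coe_exp, Complex.exp_ofReal_mul_I_re, h2] at h1
  have h3 := Real.cos_neg_of_pi_div_two_lt_of_lt (x := min |a| Real.pi)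
    (lt_min ha (by linarith [Real.pi_pos]))
    ((min_le_right _ _).trans_lt (by linarith [Real.pi_pos]))
  linarith

/-- The character of the free abelian group with phase given by a real function on the
generators. -/
noncomputable def expChar {X : Type*} (f : X → ℝ) : AddChar (FreeAbelianGroup X) Circle where
  toFun g := Circle.exp (FreeAbelianGroup.lift f g)
  map_zero_eq_one' := by simp
  map_add_eq_mul' g h := by simp [Circle.exp_add]

theorem expChar_apply {X : Type*} (f : X → ℝ) (g : FreeAbelianGroup X) :
    expChar f g = Circle.exp (FreeAbelianGroup.lift f g) := rfl

theorem exists_eq_sum_sub_sum {X : Type*} (g : FreeAbelianGroup X) :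
    ∃ (s t : List X), g = (s.map FreeAbelianGroup.of).sum - (t.map FreeAbelianGroup.of).sum := by
  induction g using FreeAbelianGroup.induction_on with
  | zero => exact ⟨[], [], by simp⟩
  | of x => exact ⟨[x], [], by simp⟩
  | neg x _ => exact ⟨[], [x], by simp⟩
  | add g h hg hh =>
    obtain ⟨s, t, rfl⟩ := hg
    obtain ⟨s', t', rfl⟩ := hh
    exact ⟨s ++ s', t ++ t', by simp; abel⟩

/-- Degree zero means equally many positive and negative generators, so `g` becomes a transportation
problem with unit masses. -/
theorem exists_eq_sum_sub_sum_of_lift_one_eq_zero {X : Type*} {g : FreeAbelianGroup X}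
    (hg : FreeAbelianGroup.lift (fun _ => (1 : ℝ)) g = 0) : ∃ (n : ℕ) (x y : Fin n → X),
      g = ∑ i, FreeAbelianGroup.of (x i) - ∑ i, FreeAbelianGroup.of (y i) := by
  obtain ⟨s, t, rfl⟩ := exists_eq_sum_sub_sum g
  have h : s.length = t.length := by
    have h1 (l : List X) : FreeAbelianGroup.lift (fun _ => (1 : ℝ))
        (l.map FreeAbelianGroup.of).sum = l.length := by
      induction l with
      | nil => simp
      | cons a l ih =>
        rw [List.map_cons, List.sum_cons, map_add, ih, FreeAbelianGroup.lift_apply_of]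
        simp [add_comm]
    rw [map_sub, h1, h1, sub_eq_zero] at hg
    exact_mod_cast hg
  refine ⟨s.length, s.get, fun i => t.get (i.cast h), ?_⟩
  congr 1
  · rw [← List.sum_ofFn]
    congr 1
    apply List.ext_get <;> simp
  · rw [← List.sum_ofFn]
    congr 1
    apply List.ext_get <;> simp [h]

/-- The free abelian topological group over any space is locally quasi-convex. -/
theorem isLocallyQuasiConvex_freeTopology (X : Type*) [TopologicalSpace X] :
    IsLocallyQuasiConvex (freeTopology X) := by
  rw [isLocallyQuasiConvex_iff]
  intro V hV
  obtain ⟨N, hN, hNV⟩ := exists_seminorm_ball_subset _ hV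
  -- With the factor `2`, the bound `π / 2 + 1 / 5 < 2` obtained at the end for the transport cost
  -- gives `N g < 1`.
  let d : X → X → ℝ := fun x y => 2 * N (FreeAbelianGroup.of x - FreeAbelianGroup.of y)
  have d_self (x : X) : d x x = 0 := by simp [d]
  have d_comm (x y : X) : d x y = d y x := by simp only [d, map_sub_rev]
  have d_triangle (x y z : X) : d x z ≤ d x y + d y z := by
    have := map_add_le_add N (FreeAbelianGroup.of x - FreeAbelianGroup.of y)
      (FreeAbelianGroup.of y - FreeAbelianGroup.of z)
    rw [sub_add_sub_cancel] at this
    simp only [d]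
    linarith
  have d_nhds (x : X) {ε : ℝ} (hε : 0 < ε) : ∀ᶠ y in 𝓝 x, d y x < ε := by
    let _ := (freeTopology X).toTopologicalSpace
    have := (freeTopology X).toIsTopologicalAddGroup
    have h1 : Filter.Tendsto (fun y => FreeAbelianGroup.of y - FreeAbelianGroup.of x) (𝓝 x)
        (𝓝 (0 : FreeAbelianGroup X)) := by
      rw [← sub_self (FreeAbelianGroup.of x)]
      exact (continuous_of.sub continuous_const).tendsto x
    filter_upwards [h1.eventually (hN (ε / 2) (half_pos hε))] with y hy
    have hy' : N (FreeAbelianGroup.of y - FreeAbelianGroup.of x) < ε / 2 := hy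
    simp only [d]
    linarith
  let χ : {f : X → ℝ // ∀ a b, f a - f b ≤ d a b} → AddChar (FreeAbelianGroup X) Circle :=
    fun f => expChar f.1
  have hχd (f) (x y : X) : dist (χ f (FreeAbelianGroup.of x)) (χ f (FreeAbelianGroup.of y)) ≤
      d x y := by
    simp only [χ, expChar_apply, FreeAbelianGroup.lift_apply_of]
    refine (Circle.dist_exp_exp_le _ _).trans (abs_le.2 ⟨?_, f.2 x y⟩)
    linarith [f.2 y x, d_comm x y]
  have hχ (f) : χ f ∈ dual (freeTopology X) := by
    rw [mem_dual_freeTopology, continuous_iff_continuousAt]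
    refine fun x => Metric.tendsto_nhds.2 fun ε hε => ?_
    filter_upwards [d_nhds x hε] with y hy
    exact (hχd f y x).trans_lt hy
  refine ⟨{g | ∀ f, χ f g ∈ circlePos}, ?_, isQuasiConvex_polar hχ, fun g hg => ?_⟩
  · have hle : freeTopology X ≤ seminormTopology (uniformSeminorm χ) := by
      refine freeTopology_le ?_
      let _ := (seminormTopology (uniformSeminorm χ)).toTopologicalSpace
      rw [continuous_iff_continuousAt]
      refine fun x => (nhds_seminormTopology _ _).tendsto_right_iff.2 fun ε hε => ?_
      filter_upwards [d_nhds x (half_pos hε)] with y hy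
      refine (uniformSeminorm_le (half_pos hε).le fun f => ?_).trans_lt (half_lt_self hε)
      rw [sub_eq_add_neg, AddChar.map_add_eq_mul, AddChar.map_neg_eq_inv,
        ← Circle.dist_mul_left (χ f (FreeAbelianGroup.of x)), mul_one, mul_comm,
        inv_mul_cancel_right]
      exact (hχd f y x).trans hy.le
    refine nhds_mono (AddGroupTopology.toTopologicalSpace_le.2 hle)
      ((nhds_seminormTopology _ _).mem_iff.2 ⟨1, one_pos, fun g hg f => ?_⟩)
    rw [Set.mem_ofPred_eq, sub_zero] at hg
    exact mem_circlePos_of_dist_one_le ((dist_le_uniformSeminorm χ f g).trans hg.le)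
  · have hlift (f : X → ℝ) (t : ℝ) : FreeAbelianGroup.lift (fun x => t * f x) g =
        t * FreeAbelianGroup.lift f g := by
      have : FreeAbelianGroup.lift (fun x => t * f x) =
          (AddMonoidHom.mulLeft t).comp (FreeAbelianGroup.lift f) :=
        FreeAbelianGroup.lift_ext _ _ fun x => by simp
      rw [this]
      rfl
    have hbound (f : X → ℝ) (hf : ∀ a b, f a - f b ≤ d a b) :
        |FreeAbelianGroup.lift f g| ≤ Real.pi / 2 := by
      refine abs_le_of_forall_exp_mem_circlePos fun t ht => ?_
      rw [← hlift, ← expChar_apply]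
      refine hg ⟨fun x => t * f x, fun a b => ?_⟩
      have hd : 0 ≤ d a b := mul_nonneg zero_le_two (apply_nonneg N _)
      rw [← mul_sub]
      nlinarith [hf a b, ht.1, ht.2]
    -- Every constant function is Lipschitz, so all real multiples of the degree of `g` are bounded
    -- by `π / 2`.
    have hdeg : FreeAbelianGroup.lift (fun _ => (1 : ℝ)) g = 0 := by
      have h1 (t : ℝ) : |t * FreeAbelianGroup.lift (fun _ => (1 : ℝ)) g| ≤ Real.pi / 2 := by
        rw [← hlift]
        refine hbound _ fun a b => ?_
        rw [sub_self]
        exact mul_nonneg zero_le_two (apply_nonneg N _)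
      by_contra h0
      have h2 := h1 (Real.pi / FreeAbelianGroup.lift (fun _ => (1 : ℝ)) g)
      rw [div_mul_cancel₀ _ h0, abs_of_pos Real.pi_pos] at h2
      linarith [Real.pi_pos]
    obtain ⟨n, x, y, rfl⟩ := exists_eq_sum_sub_sum_of_lift_one_eq_zero hdeg
    obtain ⟨f, σ, hf, hfσ⟩ := exists_lipschitz_perm_sum_le d_self d_triangle x y
      (δ := 1 / 5) (by norm_num)
    have h1 := (le_abs_self _).trans (hbound f hf)
    simp only [map_sub, map_sum, FreeAbelianGroup.lift_apply_of] at h1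
    refine hNV ?_
    have h2 : ∑ i, FreeAbelianGroup.of (x i) - ∑ i, FreeAbelianGroup.of (y i) =
        ∑ i, (FreeAbelianGroup.of (x i) - FreeAbelianGroup.of (y (σ i))) := by
      rw [Finset.sum_sub_distrib, Equiv.sum_comp σ fun i => FreeAbelianGroup.of (y i)]
    rw [Set.mem_ofPred_eq, h2]
    have h3 := Finset.le_sum_of_subadditive N (map_zero N).le (map_add_le_add N) Finset.univ
      fun i => FreeAbelianGroup.of (x i) - FreeAbelianGroup.of (y (σ i))
    simp only [d, ← Finset.mul_sum] at hfσ
    linarith [Real.pi_lt_d2]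

end Free

/-! ### Elements of the circle all of whose powers have infinite order -/

/-- Every nontrivial power of `c` generates a dense subgroup of the circle. -/
def HasDensePowers (c : Circle) : Prop :=
  ∀ m : ℤ, m ≠ 0 → DenseRange fun k : ℤ => (c ^ m) ^ k

theorem hasDensePowers_exp {a : ℝ} (ha : Irrational (a / (2 * Real.pi))) :
    HasDensePowers (Circle.exp a) := by
  intro m hm
  have h0 : (2 * Real.pi) ≠ 0 := by positivity
  have h1 : DenseRange fun k : ℤ => k • ((m * a : ℝ) : AddCircle (2 * Real.pi)) := by
    rw [AddCircle.denseRange_zsmul_coe_iff, mul_div_assoc]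
    exact ha.intCast_mul hm
  have h2 : Function.Surjective (AddCircle.toCircle (T := 2 * Real.pi)) := fun z =>
    ⟨((Complex.arg z : ℝ) : AddCircle (2 * Real.pi)), by
      rw [AddCircle.toCircle_apply_mk, div_self h0, one_mul, Circle.exp_arg]⟩
  have h3 := h2.denseRange.comp h1 AddCircle.continuous_toCircle
  convert h3 using 2 with k
  rw [Function.comp_apply, AddCircle.toCircle_zsmul, AddCircle.toCircle_apply_mk, div_self h0,
    one_mul, ← zsmul_eq_mul, Circle.exp_zsmul]

theorem hasDensePowers_exp_one : HasDensePowers (Circle.exp 1) :=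
  hasDensePowers_exp (by
    rw [one_div, irrational_inv_iff]
    exact_mod_cast irrational_pi.natCast_mul (two_ne_zero))

/-- The second base is the negative of `Circle.exp 1`; a shift by the rational `1 / 2` keeps the
rotation number irrational. -/
theorem hasDensePowers_exp_one_add_pi : HasDensePowers (Circle.exp (1 + Real.pi)) :=
  hasDensePowers_exp (by
    have h : (1 + Real.pi) / (2 * Real.pi) = 1 / (2 * Real.pi) + ((1 / 2 : ℚ) : ℝ) := by
      have := Real.pi_ne_zero
      push_cast
      field_simp
    rw [h]
    refine Irrational.add_ratCast _ ?_
    rw [one_div, irrational_inv_iff]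
    exact_mod_cast irrational_pi.natCast_mul (two_ne_zero))

theorem HasDensePowers.exists_zpow_dist_lt {c : Circle} (hc : HasDensePowers c) {m : ℤ}
    (hm : m ≠ 0) (a : Circle) {ε : ℝ} (hε : 0 < ε) : ∃ k : ℤ, dist ((c ^ m) ^ k) a < ε := by
  obtain ⟨k, hk⟩ := Metric.denseRange_iff.1 (hc m hm) a ε hε
  exact ⟨k, by rwa [dist_comm]⟩

/-- If `u ^ m = 1` whenever `c ^ m` is close to `1`, then `u = 1`. -/
theorem HasDensePowers.eq_one {c : Circle} (hc : HasDensePowers c) {u : Circle} {ε : ℝ}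
    (hε : 0 < ε) (h : ∀ m : ℤ, dist (c ^ m) 1 < ε → u ^ m = 1) : u = 1 := by
  -- The exponent `2` makes `1 + 2 * k` odd, hence nonzero, so density applies again to `c ^ (1 + 2
  -- * k)`. Both `1 + 2 * k` and `1 + (1 + 2 * k) * l` then kill `u`, and these exponents are
  -- coprime.
  obtain ⟨k, hk⟩ := hc.exists_zpow_dist_lt two_ne_zero c⁻¹ hε
  rw [← Circle.dist_mul_left c, mul_inv_cancel, ← zpow_mul, ← zpow_one_add] at hk
  obtain ⟨l, hl⟩ := hc.exists_zpow_dist_lt (m := 1 + 2 * k) (by omega) c⁻¹ hε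
  rw [← Circle.dist_mul_left c, mul_inv_cancel, ← zpow_mul, ← zpow_one_add] at hl
  have h1 := h _ hl
  rwa [zpow_add, zpow_mul, h _ hk, one_zpow, mul_one, zpow_one] at h1

/-! ### Refinements of the free topology by block characters -/

section Block

variable {X : Type*} {κ : Type*}

open Classical in
/-- For a disjoint family `U` of subsets of `X`, the homomorphism sending `g` to the family of sums
of its coefficients over the sets `U i`. -/
noncomputable def blockHom (U : κ → Set X) : FreeAbelianGroup X →+ (κ →₀ ℤ) :=
  FreeAbelianGroup.lift fun x => if h : ∃ i, x ∈ U i then Finsupp.single h.choose 1 else 0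

variable {U : κ → Set X}

theorem blockHom_of_mem (hdisj : ∀ i j, i ≠ j → Disjoint (U i) (U j)) {x : X} {i : κ}
    (hx : x ∈ U i) : blockHom U (FreeAbelianGroup.of x) = Finsupp.single i 1 := by
  have h : ∃ i, x ∈ U i := ⟨i, hx⟩
  have hi : h.choose = i := by
    by_contra hne
    exact Set.disjoint_left.1 (hdisj _ _ hne) h.choose_spec hx
  rw [blockHom, FreeAbelianGroup.lift_apply_of, dif_pos h, hi]

theorem blockHom_of_forall_notMem {x : X} (hx : ∀ i, x ∉ U i) :
    blockHom U (FreeAbelianGroup.of x) = 0 := by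
  rw [blockHom, FreeAbelianGroup.lift_apply_of, dif_neg (by simpa using hx)]

theorem blockHom_of_apply_of_notMem (hdisj : ∀ i j, i ≠ j → Disjoint (U i) (U j)) {x : X} {i : κ}
    (hx : x ∉ U i) : blockHom U (FreeAbelianGroup.of x) i = 0 := by
  by_cases h : ∃ j, x ∈ U j
  · obtain ⟨j, hj⟩ := h
    rw [blockHom_of_mem hdisj hj, Finsupp.single_eq_of_ne]
    rintro rfl
    exact hx hj
  · rw [blockHom_of_forall_notMem (by simpa using h), Finsupp.zero_apply]

/-- The character `g ↦ c ^ (sum of the coefficients of g over U i)`. -/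
noncomputable def blockChar (U : κ → Set X) (c : Circle) (i : κ) :
    AddChar (FreeAbelianGroup X) Circle where
  toFun g := c ^ blockHom U g i
  map_zero_eq_one' := by simp
  map_add_eq_mul' g h := by simp [zpow_add]

theorem blockChar_apply (c : Circle) (i : κ) (g : FreeAbelianGroup X) :
    blockChar U c i g = c ^ blockHom U g i := rfl

variable [TopologicalSpace X]

theorem blockChar_mem_dual (hU : ∀ i, IsClopen (U i))
    (hdisj : ∀ i j, i ≠ j → Disjoint (U i) (U j)) (c : Circle) (i : κ) :
    blockChar U c i ∈ dual (freeTopology X) := by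
  classical
  rw [mem_dual_freeTopology]
  have h : (fun x => blockChar U c i (FreeAbelianGroup.of x)) =
      (U i).piecewise (fun _ => c) fun _ => 1 := by
    ext1 x
    by_cases hx : x ∈ U i
    · rw [blockChar_apply, blockHom_of_mem hdisj hx, Set.piecewise_eq_of_mem _ _ _ hx,
        Finsupp.single_eq_same, zpow_one]
    · rw [blockChar_apply, blockHom_of_apply_of_notMem hdisj hx,
        Set.piecewise_eq_of_notMem _ _ _ hx, zpow_zero]
  rw [h]
  exact continuous_const.piecewise (by simp [(hU i).frontier_eq]) continuous_const

/-- The free topology refined by uniform convergence on the block characters of base `c`. -/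
noncomputable def blockTopology (U : κ → Set X) (c : Circle) :
    AddGroupTopology (FreeAbelianGroup X) :=
  freeTopology X ⊓ seminormTopology (uniformSeminorm (blockChar U c))

theorem blockTopology_le (c : Circle) : blockTopology U c ≤ freeTopology X := inf_le_left

theorem isLocallyQuasiConvex_blockTopology (hU : ∀ i, IsClopen (U i))
    (hdisj : ∀ i j, i ≠ j → Disjoint (U i) (U j)) (c : Circle) :
    IsLocallyQuasiConvex (blockTopology U c) :=
  (isLocallyQuasiConvex_freeTopology X).inf_uniform (blockChar_mem_dual hU hdisj c)

theorem uniform_ball_mem_nhds_blockTopology (c : Circle) {ε : ℝ} (hε : 0 < ε) :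
    {g | uniformSeminorm (blockChar U c) g < ε} ∈
      @nhds _ (blockTopology U c).toTopologicalSpace 0 := by
  rw [blockTopology, nhds_inf_seminormTopology]
  exact Filter.mem_inf_of_right ((nhds_seminormTopology _ _).mem_iff.2 ⟨ε, hε, by simp⟩)

/-- Small elements of `A(X)` with all block sums in `{0, m}`, on which a character takes values
close to `(u ^ m) ^ L`, where `u` is a limit of its values at `x - p` for `x` tending to `p`. -/
theorem exists_mem_blockHom_eq_zero_or_eq (hU : ∀ i, IsClopen (U i))
    (hdisj : ∀ i j, i ≠ j → Disjoint (U i) (U j)) {p : X} (hp : ∀ i, p ∉ U i)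
    {χ : AddChar (FreeAbelianGroup X) Circle} {F : Filter X} [F.NeBot] (hF : F ≤ 𝓝 p)
    {u : Circle} (hu : Filter.Tendsto
      (fun x => χ (FreeAbelianGroup.of x - FreeAbelianGroup.of p)) F (𝓝 u)) (m : ℤ) (L : ℕ)
    {V : Set (FreeAbelianGroup X)} (hV : V ∈ @nhds _ (freeTopology X).toTopologicalSpace 0)
    {O : Set Circle} (hO : O ∈ 𝓝 ((u ^ m) ^ L)) :
    ∃ g ∈ V, (∀ i, blockHom U g i = 0 ∨ blockHom U g i = m) ∧ χ g ∈ O := by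
  let _ := (freeTopology X).toTopologicalSpace
  have := (freeTopology X).toIsTopologicalAddGroup
  induction L generalizing V O with
  | zero =>
    refine ⟨0, mem_of_mem_nhds hV, by simp, ?_⟩
    rw [AddChar.map_zero_eq_one]
    simpa using mem_of_mem_nhds hO
  | succ L ih =>
    obtain ⟨V', hV', hVV⟩ := exists_nhds_zero_half hV
    rw [pow_succ] at hO
    obtain ⟨O₁, hO₁, O₂, hO₂, hOO⟩ := Filter.mem_prod_iff.1
      (nhds_prod_eq (x := (u ^ m) ^ L) (y := u ^ m) ▸ continuous_mul.tendsto _ hO)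
    obtain ⟨g, hgV, hg, hgO⟩ := ih hV' hO₁
    have h1 : Filter.Tendsto (fun x => m • (FreeAbelianGroup.of x - FreeAbelianGroup.of p)) F
        (𝓝 (0 : FreeAbelianGroup X)) := by
      have : Continuous fun x : X => m • (FreeAbelianGroup.of x - FreeAbelianGroup.of p) :=
        (continuous_zsmul m).comp ((continuous_sub_right _).comp continuous_of)
      simpa using (this.tendsto p).mono_left hF
    -- Near `p` the next point avoids the finitely many blocks already in use, so block sums never
    -- accumulate beyond `m`.
    have h2 : ∀ᶠ x in F, ∀ i ∈ (blockHom U g).support, x ∉ U i :=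
      (Filter.eventually_all_finset _).2 fun i _ =>
        hF ((hU i).compl.isOpen.mem_nhds (hp i))
    obtain ⟨x, hx1, hx2, hx3⟩ := ((h1.eventually hV').and
      (h2.and ((hu.zpow m).eventually hO₂))).exists
    refine ⟨g + m • (FreeAbelianGroup.of x - FreeAbelianGroup.of p), hVV _ hgV _ hx1,
      fun i => ?_, ?_⟩
    · rw [map_add, map_zsmul, map_sub, blockHom_of_forall_notMem hp, sub_zero, Finsupp.add_apply,
        Finsupp.smul_apply]
      by_cases hi : x ∈ U i
      · right
        have : blockHom U g i = 0 := by
          by_contra h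
          exact hx2 i (Finsupp.mem_support_iff.2 h) hi
        rw [this, blockHom_of_mem hdisj hi, Finsupp.single_eq_same, zero_add, smul_eq_mul, mul_one]
      · rw [blockHom_of_apply_of_notMem hdisj hi, smul_zero, add_zero]
        exact hg i
    · rw [AddChar.map_add_eq_mul, AddChar.map_zsmul_eq_zpow]
      exact hOO (Set.mk_mem_prod hgO hx3)

theorem dual_blockTopology_subset (hU : ∀ i, IsClopen (U i))
    (hdisj : ∀ i j, i ≠ j → Disjoint (U i) (U j)) {p : X} (hcover : ⋃ i, U i = {p}ᶜ)
    {c : Circle} (hc : HasDensePowers c) :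
    dual (blockTopology U c) ⊆ dual (freeTopology X) := by
  intro χ hχ
  have hp (i : κ) : p ∉ U i := fun h => (hcover ▸ Set.mem_iUnion_of_mem i h : p ∈ ({p} : Set X)ᶜ) rfl
  rw [mem_dual_freeTopology, continuous_iff_continuousAt]
  have hχt (g) : Filter.Tendsto χ (@nhds _ (blockTopology U c).toTopologicalSpace g)
      (𝓝 (χ g)) := by
    let _ := (blockTopology U c).toTopologicalSpace
    exact Continuous.tendsto (f := χ) hχ g
  intro x
  by_cases hx : x = p
  · subst hx
    refine (Filter.tendsto_iff_ultrafilter _ _ _).2 fun F hF => ?_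
    let ψ : X → Circle := fun y => χ (FreeAbelianGroup.of y - FreeAbelianGroup.of x)
    obtain ⟨u, hu⟩ : ∃ u, Filter.Tendsto ψ F (𝓝 u) := ⟨_, (F.map ψ).le_nhds_lim⟩
    have h0 := (hχt 0).eventually (Metric.closedBall_mem_nhds (χ 0) one_pos)
    rw [blockTopology, nhds_inf_seminormTopology, AddChar.map_zero_eq_one] at h0
    obtain ⟨V, hV, W, hW, hVW⟩ := Filter.mem_inf_iff_superset.1 h0
    obtain ⟨ε, hε, hεW⟩ := (nhds_seminormTopology _ _).mem_iff.1 hW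
    -- The bound on `(u ^ m) ^ L` is uniform in `L`, and no nontrivial subgroup of the circle lies
    -- in the right half.
    have hu1 : u = 1 := by
      refine hc.eq_one hε fun m hm => ?_
      refine eq_one_of_forall_pow_mem_circlePos fun L => mem_circlePos_of_dist_one_le ?_
      have hcl : (u ^ m) ^ L ∈ closure (Metric.closedBall (1 : Circle) 1) := by
        refine mem_closure_iff_nhds.2 fun O hO => ?_
        obtain ⟨g, hgV, hg, hgO⟩ := exists_mem_blockHom_eq_zero_or_eq hU hdisj hp hF hu m L hV hO
        refine ⟨χ g, hgO, hVW ⟨hgV, hεW ?_⟩⟩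
        rw [Set.mem_ofPred_eq, sub_zero]
        refine (uniformSeminorm_le dist_nonneg fun i => ?_).trans_lt hm
        rw [blockChar_apply]
        rcases hg i with h | h <;> simp [h]
      rwa [Metric.isClosed_closedBall.closure_eq] at hcl
    have h1 := hu.mul_const (χ (FreeAbelianGroup.of x))
    rw [hu1, one_mul] at h1
    refine h1.congr fun y => ?_
    rw [← AddChar.map_add_eq_mul, sub_add_cancel]
  -- Away from `p`, points `y` near `x` lie in the same block, so `y - x` has zero block sums and
  -- the refinement changes nothing.
  · obtain ⟨i, hi⟩ : ∃ i, x ∈ U i := Set.mem_iUnion.1 (hcover ▸ hx : x ∈ ⋃ i, U i)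
    refine (hχt _).comp ?_
    rw [blockTopology, nhds_inf_seminormTopology]
    refine Filter.tendsto_inf.2 ⟨?_, (nhds_seminormTopology _ _).tendsto_right_iff.2 fun ε hε => ?_⟩
    · let _ := (freeTopology X).toTopologicalSpace
      exact continuous_of.tendsto x
    · filter_upwards [(hU i).isOpen.mem_nhds hi] with y hy
      refine (uniformSeminorm_le le_rfl fun j => ?_).trans_lt hε
      rw [blockChar_apply, map_sub, blockHom_of_mem hdisj hi, blockHom_of_mem hdisj hy]
      simp

theorem compatible_blockTopology (hU : ∀ i, IsClopen (U i))
    (hdisj : ∀ i j, i ≠ j → Disjoint (U i) (U j)) {p : X} (hcover : ⋃ i, U i = {p}ᶜ)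
    {c : Circle} (hc : HasDensePowers c) : Compatible (blockTopology U c) (freeTopology X) :=
  (dual_blockTopology_subset hU hdisj hcover hc).antisymm (dual_anti (blockTopology_le c))

/-- The character equal to `-1` at the points of the sets `U i`. -/
noncomputable def signChar (U : κ → Set X) : AddChar (FreeAbelianGroup X) Circle where
  toFun g := (blockHom U g).prod fun _ m => Circle.exp Real.pi ^ m
  map_zero_eq_one' := by simp
  map_add_eq_mul' g h := by
    rw [map_add, Finsupp.prod_add_index' (fun _ => zpow_zero _) fun _ _ _ => zpow_add _ _ _]

theorem signChar_mem_dual {c : Circle} {μ : AddGroupTopology (FreeAbelianGroup X)}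
    (h1 : μ ≤ blockTopology U c) (h2 : μ ≤ blockTopology U (c * Circle.exp Real.pi)) :
    signChar U ∈ dual μ := by
  refine mem_dual_of_tendsto (Filter.Tendsto.congr' ?_ tendsto_const_nhds)
  filter_upwards [nhds_mono (AddGroupTopology.toTopologicalSpace_le.2 h1)
      (uniform_ball_mem_nhds_blockTopology c one_pos),
    nhds_mono (AddGroupTopology.toTopologicalSpace_le.2 h2)
      (uniform_ball_mem_nhds_blockTopology _ one_pos)] with g hg1 hg2
  have hpi : (Circle.exp Real.pi : ℂ) = -1 := by rw [Circle.coe_exp, Complex.exp_pi_mul_I]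
  refine (Finset.prod_eq_one fun i _ => ?_).symm
  have h3 := (dist_le_uniformSeminorm _ i g).trans_lt hg1
  have h4 := (dist_le_uniformSeminorm _ i g).trans_lt hg2
  rw [blockChar_apply] at h3 h4
  generalize blockHom U g i = m at h3 h4 ⊢
  rcases Int.even_or_odd m with hm | hm
  · rw [← Circle.coe_eq_one, Circle.coe_zpow, hpi, hm.neg_one_zpow]
  · rw [Circle.dist_eq] at h3 h4
    rw [mul_zpow, Circle.coe_mul, Circle.coe_zpow (Circle.exp _), hpi, hm.neg_one_zpow] at h4
    -- For odd `m`, the numbers `c ^ m - 1` and `-c ^ m - 1` add up to `-2`, so they cannot both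
    -- have norm below `1`.
    have h5 := norm_add_le (((c ^ m : Circle) : ℂ) - (1 : Circle))
      (((c ^ m : Circle) : ℂ) * -1 - (1 : Circle))
    have h6 : (((c ^ m : Circle) : ℂ) - (1 : Circle)) +
        (((c ^ m : Circle) : ℂ) * -1 - (1 : Circle)) = -2 := by
      rw [Circle.coe_one]; ring
    rw [h6, norm_neg, Complex.norm_ofNat] at h5
    linarith

theorem signChar_notMem_dual (hdisj : ∀ i j, i ≠ j → Disjoint (U i) (U j)) {p : X}
    (hp : ¬ IsOpen ({p} : Set X)) (hcover : ⋃ i, U i = {p}ᶜ) :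
    signChar U ∉ dual (freeTopology X) := by
  rw [mem_dual_freeTopology]
  refine fun h => hp ?_
  have hpi : Circle.exp Real.pi ≠ 1 := by
    rw [Ne, ← Circle.coe_eq_one, Circle.coe_exp, Complex.exp_pi_mul_I]
    norm_num
  convert (isOpen_compl_singleton (x := Circle.exp Real.pi)).preimage h using 1
  ext x
  by_cases hx : ∃ i, x ∈ U i
  · have hxp : x ≠ p := by
      have : x ∈ ⋃ i, U i := Set.mem_iUnion.2 hx
      rwa [hcover] at this
    obtain ⟨i, hi⟩ := hx
    simp [hxp, signChar, blockHom_of_mem hdisj hi]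
  · have hxp : x = p := by
      have : x ∉ ⋃ i, U i := fun h' => hx (Set.mem_iUnion.1 h')
      rw [hcover] at this
      simpa using this
    subst hxp
    simp [signChar, blockHom_of_forall_notMem (not_exists.1 hx), hpi.symm]

end Block

end MackeyTop

theorem theoremt {X : Type*} [TopologicalSpace X] (hX : MackeyTop.IsZeroDimensional X)
    {κ : Type*} (U : κ → Set X) (hU : ∀ i, IsClopen (U i))
    (hdisj : ∀ i j, i ≠ j → Disjoint (U i) (U j))
    (xinf : X) (hxinf : ¬ IsOpen ({xinf} : Set X))
    (hcover : ⋃ i, U i = {xinf}ᶜ) :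
    MackeyTop.IsLocallyQuasiConvex (MackeyTop.freeTopology X) ∧
      ¬ MackeyTop.IsPreMackey (MackeyTop.freeTopology X) ∧
      ¬ MackeyTop.IsQuasiMackey (MackeyTop.freeTopology X) := by
  open MackeyTop in
  have hlqc (c : Circle) := isLocallyQuasiConvex_blockTopology hU hdisj c
  have hcomp₁ := compatible_blockTopology hU hdisj hcover hasDensePowers_exp_one
  have hcomp₂ := compatible_blockTopology hU hdisj hcover hasDensePowers_exp_one_add_pi
  have hkey (μ : AddGroupTopology (FreeAbelianGroup X)) (h₁ : μ ≤ blockTopology U (Circle.exp 1))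
      (h₂ : μ ≤ blockTopology U (Circle.exp (1 + Real.pi)))
      (hμ : Compatible μ (freeTopology X)) : False := by
    rw [Circle.exp_add] at h₂
    exact signChar_notMem_dual hdisj hxinf hcover (hμ ▸ signChar_mem_dual h₁ h₂)
  refine ⟨isLocallyQuasiConvex_freeTopology X, ?_, ?_⟩
  · rintro ⟨μ, ⟨-, hμ⟩, hμτ⟩
    exact hkey μ (hμ _ (hlqc _) (hcomp₁.trans hμτ.symm)) (hμ _ (hlqc _) (hcomp₂.trans hμτ.symm))
      hμτ
  · rintro ⟨-, -, hτ⟩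
    -- The block topologies are finer than the free one, so maximality of the latter leaves only
    -- equality.
    have hle {c : Circle} (hc : Compatible (blockTopology U c) (freeTopology X)) :
        freeTopology X ≤ blockTopology U c := by
      by_contra h
      exact hτ ⟨_, hlqc c, hc, lt_of_le_not_ge (blockTopology_le c) h⟩
    exact hkey _ (hle hcomp₁) (hle hcomp₂) rfl
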